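/- Let $\mathsf{ZFA}$ be the first-order theory, in the language $L=\{\in\}$, given by the axioms of $\mathsf{ZFC}$ with Foundation replaced by the Anti-Foundation Axiom: every flat system of equations $\{x=S_x : x\in X\}$, where $X$ is a set of indeterminates, $A$ is a set and $S_x\subseteq X\cup A$ for each $x\in X$, has a unique solution, i.e. there is a unique function $f$ with domain $X$ such that, for every $x\in X$, the set $f(x)$ is obtained from $S_x$ by replacing each $y\in S_x\cap X$ with $f(y)$. For an $L$-structure $M$, let $M_0$ be the structure with the same domain in the language $L_0=\{S,D\}$, where $S(x,y)$ holds iff $x\in y$ or $y\in x$, and $D(x,y)$ holds iff $x\in y$ and $y\in x$. Let $L_1=\{D\}$; connected components and diameters of an $L_0$-structure are those of the graph given by its reduct to $L_1$. **Theorem.** Let $M\models\mathsf{ZFA}$. There is a countable $L_0$-structure $N\equiv M_0$ such that the reduct $N\upharpoonright L_1$ has no connected component of infinite diameter. Moreover, if $M$ is countable, then one can take as $N$ the substructure of $M_0$ obtained by removing all points whose connected component in $M_0\upharpoonright L_1$ has infinite diameter. -/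

import Mathlib

open FirstOrder FirstOrder.Language

namespace DoubleMembership

/-! ### The languages `L = {∈}`, `L₀ = {S, D}` and `L₁ = {D}` -/

inductive MemRel : ℕ → Type
  | mem : MemRel 2

inductive SDRel : ℕ → Type
  | single : SDRel 2
  | double : SDRel 2

inductive DRel : ℕ → Type
  | double : DRel 2

/-- The language with a single binary relation symbol `∈`. -/
abbrev langMem : FirstOrder.Language.{0, 0} := ⟨fun _ => Empty, MemRel⟩

/-- The language with two binary relation symbols `S` and `D`. -/
abbrev langSD : FirstOrder.Language.{0, 0} := ⟨fun _ => Empty, SDRel⟩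

/-- The language with a single binary relation symbol `D`. -/
abbrev langD : FirstOrder.Language.{0, 0} := ⟨fun _ => Empty, DRel⟩

/-- The inclusion of `{D}` into `{S, D}`. -/
def inclD : langD →ᴸ langSD where
  onFunction := fun {_} f => f
  onRelation := fun {_} r => match r with
    | DRel.double => SDRel.double

/-! ### The theory ZFA

Formulas are written with all variables bound: in `Fml n` the variables in scope are numbered
`0, …, n - 1` from the outermost quantifier inwards, so that a new quantifier binds variable `n`. -/

section Axioms

abbrev Fml (n : ℕ) := langMem.BoundedFormula Empty n

variable {n : ℕ}

/-- `i = j`. -/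
def eqF (i j : Fin n) : Fml n :=
  Term.bdEqual (Term.var (Sum.inr i)) (Term.var (Sum.inr j))

/-- `i ∈ j`. -/
def memF (i j : Fin n) : Fml n :=
  Relations.boundedFormula₂ (L := langMem) MemRel.mem
    (Term.var (Sum.inr i)) (Term.var (Sum.inr j))

/-- `z = {x, y}`. -/
def pairF (x y z : Fin n) : Fml n :=
  ∀' (memF (Fin.last n) z.castSucc ⇔
    (eqF (Fin.last n) x.castSucc ⊔ eqF (Fin.last n) y.castSucc))

/-- `p` is the Kuratowski pair `{{x}, {x, y}}`. -/
def opairF (x y p : Fin n) : Fml n :=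
  ∃' ∃' (pairF x.castSucc.castSucc x.castSucc.castSucc (Fin.last n).castSucc ⊓
    (pairF x.castSucc.castSucc y.castSucc.castSucc (Fin.last (n + 1)) ⊓
      pairF (Fin.last n).castSucc (Fin.last (n + 1)) p.castSucc.castSucc))

/-- `(x, y) ∈ f`. -/
def appF (f x y : Fin n) : Fml n :=
  ∃' (opairF x.castSucc y.castSucc (Fin.last n) ⊓ memF (Fin.last n) f.castSucc)

/-- `f` is a function with domain `X`: every element of `f` is a pair `(x, y)` with `x ∈ X`, and
for every `x ∈ X` there is exactly one `y` with `(x, y) ∈ f`. -/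
def funF (f X : Fin n) : Fml n :=
  (∀' (memF (Fin.last n) f.castSucc ⟹
    ∃' ∃' (memF (Fin.last (n + 1)).castSucc X.castSucc.castSucc.castSucc ⊓
      opairF (Fin.last (n + 1)).castSucc (Fin.last (n + 2))
        (Fin.last n).castSucc.castSucc))) ⊓
  (∀' (memF (Fin.last n) X.castSucc ⟹
    ∃' ∀' (appF f.castSucc.castSucc.castSucc (Fin.last n).castSucc.castSucc (Fin.last (n + 2)) ⇔
      eqF (Fin.last (n + 2)) (Fin.last (n + 1)).castSucc)))

/-- `φ` with its `i`-th free variable replaced by variable number `g i`. -/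
def substF {α : Type} (φ : langMem.Formula α) (g : α → Fin n) : Fml n :=
  BoundedFormula.relabel (n := n) (k := 0) (fun i => Sum.inr (g i)) φ

/-- Sets with the same elements are equal. -/
def extensionality : langMem.Sentence :=
  ∀' ∀' ((∀' (memF (2 : Fin 3) 0 ⇔ memF (2 : Fin 3) 1)) ⟹ eqF (0 : Fin 2) 1)

/-- For all `x`, `y` the set `{x, y}` exists. -/
def pairing : langMem.Sentence :=
  ∀' ∀' ∃' (pairF (0 : Fin 3) 1 2)

/-- The union of every set exists. -/
def union : langMem.Sentence :=
  ∀' ∃' ∀' (memF (2 : Fin 3) 1 ⇔ ∃' (memF (3 : Fin 4) 0 ⊓ memF (2 : Fin 4) 3))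

/-- The power set of every set exists. -/
def powerSet : langMem.Sentence :=
  ∀' ∃' ∀' (memF (2 : Fin 3) 1 ⇔ ∀' (memF (3 : Fin 4) 2 ⟹ memF (3 : Fin 4) 0))

/-- There is a set which contains `∅` and, with every `x`, also `x ∪ {x}`. -/
def infinity : langMem.Sentence :=
  ∃' ((∃' (memF (1 : Fin 2) 0 ⊓ ∀' ∼(memF (2 : Fin 3) 1))) ⊓
    ∀' (memF (1 : Fin 2) 0 ⟹
      ∃' (memF (2 : Fin 3) 0 ⊓
        ∀' (memF (3 : Fin 4) 2 ⇔ (memF (3 : Fin 4) 1 ⊔ eqF (3 : Fin 4) 1)))))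

/-- Separation for the formula `φ(p₀, …, pₖ₋₁; c)`: for all parameters `p` and all `a` there is `b`
such that for all `c`, `c ∈ b ↔ c ∈ a ∧ φ(p; c)`. -/
def separation (k : ℕ) (φ : langMem.Formula (Fin k ⊕ Fin 1)) : langMem.Sentence :=
  BoundedFormula.alls (n := k) (∀' ∃' ∀'
    (memF (Fin.natAdd k (2 : Fin 3)) (Fin.natAdd k (1 : Fin 3)) ⇔
      (memF (Fin.natAdd k (2 : Fin 3)) (Fin.natAdd k (0 : Fin 3)) ⊓
        substF φ (Sum.elim (Fin.castAdd 3) ![Fin.natAdd k (2 : Fin 3)]))))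

/-- Replacement for the formula `φ(p₀, …, pₖ₋₁; x, y)`: for all parameters `p` and all `a`, if for
every `x ∈ a` there is exactly one `y` with `φ(p; x, y)`, then there is `b` such that for all `y`,
`y ∈ b ↔ ∃ x ∈ a, φ(p; x, y)`. -/
def replacement (k : ℕ) (φ : langMem.Formula (Fin k ⊕ Fin 2)) : langMem.Sentence :=
  BoundedFormula.alls (n := k) (∀'
    ((∀' (memF (Fin.natAdd k (1 : Fin 2)) (Fin.natAdd k (0 : Fin 2)) ⟹
      ∃' ∀' (substF φ (Sum.elim (Fin.castAdd 4) ![Fin.natAdd k (1 : Fin 4), Fin.natAdd k (3 : Fin 4)]) ⇔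
        eqF (Fin.natAdd k (3 : Fin 4)) (Fin.natAdd k (2 : Fin 4))))) ⟹
    ∃' ∀' (memF (Fin.natAdd k (2 : Fin 3)) (Fin.natAdd k (1 : Fin 3)) ⇔
      ∃' (memF (Fin.natAdd k (3 : Fin 4)) (Fin.natAdd k (0 : Fin 4)) ⊓
        substF φ (Sum.elim (Fin.castAdd 4) ![Fin.natAdd k (3 : Fin 4), Fin.natAdd k (2 : Fin 4)])))))

/-- Choice: for every set `F` of pairwise disjoint nonempty sets there is a set which meets every
element of `F` in exactly one point. -/
def choice : langMem.Sentence :=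
  ∀' (((∀' (memF (1 : Fin 2) 0 ⟹ ∃' (memF (2 : Fin 3) 1))) ⊓
      ∀' ∀' ∀' ((memF (1 : Fin 4) 0 ⊓ (memF (2 : Fin 4) 0 ⊓
        (memF (3 : Fin 4) 1 ⊓ memF (3 : Fin 4) 2))) ⟹ eqF (1 : Fin 4) 2)) ⟹
    ∃' ∀' (memF (2 : Fin 3) 0 ⟹
      ∃' ∀' ((memF (4 : Fin 5) 2 ⊓ memF (4 : Fin 5) 1) ⇔ eqF (4 : Fin 5) 3)))

/-- `S` codes a flat system `{x = S_x : x ∈ X}` with set of indeterminates `X` and set of constants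
`A`: `S` is a function with domain `X`, and `S_x ⊆ X ∪ A` for all `x ∈ X`. -/
def flatSystemF (X A S : Fin n) : Fml n :=
  funF S X ⊓
  ∀' ∀' (appF S.castSucc.castSucc (Fin.last n).castSucc (Fin.last (n + 1)) ⟹
    ∀' (memF (Fin.last (n + 2)) (Fin.last (n + 1)).castSucc ⟹
      (memF (Fin.last (n + 2)) X.castSucc.castSucc.castSucc ⊔
        memF (Fin.last (n + 2)) A.castSucc.castSucc.castSucc)))

/-- `f` solves the flat system `S` with set of indeterminates `X`: `f` is a function with domain
`X`, and for all `x ∈ X` the set `f(x)` arises from `S_x` by replacing every indeterminate `y` by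
`f(y)`, that is, `f(x) = {f(y) : y ∈ S_x ∩ X} ∪ (S_x \ X)`.
The variables bound here are `x`, `s = S_x`, `v = f(x)`, `z` and `y`, in this order. -/
def solutionF (X S f : Fin n) : Fml n :=
  funF f X ⊓
  ∀' ∀' ∀' ((appF (S.castAdd 3) (Fin.natAdd n (0 : Fin 3)) (Fin.natAdd n (1 : Fin 3)) ⊓
      appF (f.castAdd 3) (Fin.natAdd n (0 : Fin 3)) (Fin.natAdd n (2 : Fin 3))) ⟹
    ∀' (memF (Fin.natAdd n (3 : Fin 4)) (Fin.natAdd n (2 : Fin 4)) ⇔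
      ((∃' (memF (Fin.natAdd n (4 : Fin 5)) (Fin.natAdd n (1 : Fin 5)) ⊓
          (memF (Fin.natAdd n (4 : Fin 5)) (X.castAdd 5) ⊓
            appF (f.castAdd 5) (Fin.natAdd n (4 : Fin 5)) (Fin.natAdd n (3 : Fin 5))))) ⊔
        (memF (Fin.natAdd n (3 : Fin 4)) (Fin.natAdd n (1 : Fin 4)) ⊓
          ∼(memF (Fin.natAdd n (3 : Fin 4)) (X.castAdd 4))))))

/-- Anti-Foundation (the Solution Lemma): every flat system of equations has a unique solution. -/
def antiFoundation : langMem.Sentence :=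
  ∀' ∀' ∀' (flatSystemF (0 : Fin 3) 1 2 ⟹
    ∃' ∀' (solutionF (0 : Fin 5) 2 4 ⇔ eqF (4 : Fin 5) 3))

/-- ZFA: the axioms of ZFC with Foundation replaced by Anti-Foundation. -/
def ZFA : langMem.Theory :=
  {extensionality, pairing, union, powerSet, infinity, choice, antiFoundation} ∪
    {σ | ∃ k φ, σ = separation k φ} ∪ {σ | ∃ k φ, σ = replacement k φ}

end Axioms

/-! ### SD-graphs and components of infinite diameter -/

/-- The domain of the SD-graph `M₀` of an `{∈}`-structure `M`. -/
def SDGraph (M : Type*) : Type _ := M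

/-- The SD-graph of `M`: `S(x, y)` is `x ∈ y ∨ y ∈ x`, and `D(x, y)` is `x ∈ y ∧ y ∈ x`. -/
instance {M : Type*} [langMem.Structure M] : langSD.Structure (SDGraph M) where
  funMap := fun {_} f _ => f.elim
  RelMap := fun {_} r => match r with
    | SDRel.single => fun v =>
        Structure.RelMap (L := langMem) (M := M) MemRel.mem ![v 0, v 1] ∨
          Structure.RelMap (L := langMem) (M := M) MemRel.mem ![v 1, v 0]
    | SDRel.double => fun v =>
        Structure.RelMap (L := langMem) (M := M) MemRel.mem ![v 0, v 1] ∧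
          Structure.RelMap (L := langMem) (M := M) MemRel.mem ![v 1, v 0]

/-- The graph on a `{D}`-structure in which two distinct points are adjacent iff `D` holds between
them (in one of the two orders). Loops are irrelevant for distances and components. -/
def graphOfD (A : Type*) [langD.Structure A] : SimpleGraph A :=
  SimpleGraph.fromRel fun x y => Structure.RelMap (L := langD) DRel.double ![x, y]

/-- The graph of the reduct to `{D}` of an `{S, D}`-structure. -/
def reductGraph (A : Type*) [langSD.Structure A] : SimpleGraph A :=
  @graphOfD A (inclD.reduct A)

/-- The connected component `C` has infinite diameter. -/
def InfiniteDiam {V : Type*} {G : SimpleGraph V} (C : G.ConnectedComponent) : Prop :=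
  C.toSimpleGraph.ediam = ⊤

/-- The substructure obtained from the `{S, D}`-structure `A` by deleting all points whose connected
component in the reduct to `{D}` has infinite diameter. -/
def finiteDiamPart (A : Type*) [langSD.Structure A] : langSD.Substructure A where
  carrier := {x | ¬ InfiniteDiam ((reductGraph A).connectedComponentMk x)}
  fun_mem := fun f => f.elim

end DoubleMembership

/-!
The proof shows more: for every model `M` of ZFA, countable or not, the part `N` of the SD-graph `M₀`
which consists of the components of finite diameter is an *elementary substructure* of `M₀`. The
existence of a countable structure for an arbitrary `M` follows, since the Löwenheim–Skolem theorem
provides a countable model of ZFA elementarily equivalent to `M`, and the SD-graph is interpretable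
in the language of set theory (`translate`).

The reason is that formulas of the SD-graph are local with respect to double-membership. As the
points double-joined to `x` all belong to `x`, the ball of radius `r` around a tuple, for an actual
natural number `r`, is an element of `M`. Call two tuples locally isomorphic with radius `r` if there
is an isomorphism between their balls of radius `r`, definable in `M` with parameters, which maps one
tuple to the other. The back-and-forth step `LocallyIso.extend` adds one point `x` to the first tuple
at the price of shrinking the radius from `3 * r + 1` to `r`. If `x` is near the first tuple, the
isomorphism already provides its partner. Otherwise there is no double-membership between the ball
around `x` and the ball around the tuple, and Anti-Foundation produces a copy of the former
(`exists_copy`) which is a union of components and has the prescribed single memberships with the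
points near the second tuple. Definability of the isomorphism is what allows this prescription to be
written into a flat system of equations. Hence every formula has a radius for which it cannot
distinguish locally isomorphic tuples (`exists_radius`).

The component of the copy of `x` has diameter at most `2 * r`, so it is contained in `N`. Starting
from the identity on the ball around a tuple of `N`, the same step therefore finds witnesses in `N`,
and the Tarski–Vaught test applies.
-/

namespace DoubleMembership

/-! ### Definability with parameters -/

section Definability

variable {M : Type*} [langMem.Structure M] {n : ℕ}

/-- The membership relation of an `{∈}`-structure. -/
def Mem (x y : M) : Prop := Structure.RelMap (L := langMem) MemRel.mem ![x, y]

local infix:50 " ∊ " => Mem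

theorem realize_memF (i j : Fin n) (v : Empty → M) (xs : Fin n → M) :
    (memF i j).Realize v xs ↔ xs i ∊ xs j := by
  simp [memF, Mem, BoundedFormula.realize_rel₂]

theorem realize_eqF (i j : Fin n) (v : Empty → M) (xs : Fin n → M) :
    (eqF i j).Realize v xs ↔ xs i = xs j := by
  simp [eqF]

theorem realize_pairF (x y z : Fin n) (v : Empty → M) (xs : Fin n → M) :
    (pairF x y z).Realize v xs ↔ ∀ t, t ∊ xs z ↔ t = xs x ∨ t = xs y := by
  simp [pairF, realize_memF, realize_eqF]

/-- `P` is definable with parameters in `M`: the elements of `M` serve as free variables which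
name themselves. -/
def Dfn (P : (Fin n → M) → Prop) : Prop :=
  ∃ φ : langMem.BoundedFormula M n, ∀ v, P v ↔ φ.Realize id v

/-- The function `t` has a graph which is definable with parameters. -/
def DfnFun (t : (Fin n → M) → M) : Prop :=
  Dfn fun v : Fin (n + 1) → M => v (Fin.last n) = t (Fin.init v)

namespace Dfn

variable {P Q : (Fin n → M) → Prop}

theorem not (hP : Dfn P) : Dfn fun v => ¬ P v := by
  obtain ⟨φ, hφ⟩ := hP
  exact ⟨φ.not, fun v => by simp [hφ]⟩

theorem imp (hP : Dfn P) (hQ : Dfn Q) : Dfn fun v => P v → Q v := by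
  obtain ⟨φ, hφ⟩ := hP
  obtain ⟨ψ, hψ⟩ := hQ
  exact ⟨φ.imp ψ, fun v => by simp [hφ, hψ]⟩

theorem and (hP : Dfn P) (hQ : Dfn Q) : Dfn fun v => P v ∧ Q v := by
  obtain ⟨φ, hφ⟩ := hP
  obtain ⟨ψ, hψ⟩ := hQ
  exact ⟨φ ⊓ ψ, fun v => by simp [hφ, hψ]⟩

theorem or (hP : Dfn P) (hQ : Dfn Q) : Dfn fun v => P v ∨ Q v := by
  obtain ⟨φ, hφ⟩ := hP
  obtain ⟨ψ, hψ⟩ := hQ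
  exact ⟨φ ⊔ ψ, fun v => by simp [hφ, hψ]⟩

theorem iff (hP : Dfn P) (hQ : Dfn Q) : Dfn fun v => (P v ↔ Q v) := by
  obtain ⟨φ, hφ⟩ := hP
  obtain ⟨ψ, hψ⟩ := hQ
  exact ⟨φ.iff ψ, fun v => by simp [hφ, hψ]⟩

theorem all {R : (Fin n → M) → M → Prop}
    (h : Dfn fun v : Fin (n + 1) → M => R (Fin.init v) (v (Fin.last n))) :
    Dfn fun v => ∀ x, R v x := by
  obtain ⟨φ, hφ⟩ := h
  refine ⟨φ.all, fun v => ?_⟩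
  simp [← hφ]

theorem ex {R : (Fin n → M) → M → Prop}
    (h : Dfn fun v : Fin (n + 1) → M => R (Fin.init v) (v (Fin.last n))) :
    Dfn fun v => ∃ x, R v x := by
  obtain ⟨φ, hφ⟩ := h
  refine ⟨φ.ex, fun v => ?_⟩
  simp [← hφ]

theorem reindex {m : ℕ} (hP : Dfn P) (g : Fin n → Fin m) :
    Dfn fun v : Fin m → M => P (v ∘ g) := by
  obtain ⟨φ, hφ⟩ := hP
  refine ⟨BoundedFormula.relabel (n := m) (k := 0) (Sum.map id g) φ.toFormula, fun v => ?_⟩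
  refine (hφ _).trans ?_
  rw [BoundedFormula.realize_relabel]
  have h := BoundedFormula.realize_toFormula φ (Sum.elim id (v ∘ g) : M ⊕ Fin n → M)
  rw [Formula.Realize] at h
  rw [Sum.elim_comp_inl, Sum.elim_comp_inr] at h
  rw [← h]
  refine iff_of_eq (congrArg₂ _ ?_ (Subsingleton.elim _ _))
  ext (x | x) <;> simp

/-- Weakening by a variable in the last place but one. -/
theorem insert {R : (Fin n → M) → M → Prop}
    (h : Dfn fun v : Fin (n + 1) → M => R (Fin.init v) (v (Fin.last n))) :
    Dfn fun v : Fin (n + 2) → M => R (Fin.init (Fin.init v)) (v (Fin.last (n + 1))) := by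
  have := h.reindex (m := n + 2)
    (Fin.snoc (fun i : Fin n => i.castSucc.castSucc) (Fin.last (n + 1)))
  refine (iff_of_eq (congrArg Dfn (funext fun v => ?_))).1 this
  have h : Fin.init (v ∘ Fin.snoc (fun i : Fin n => i.castSucc.castSucc) (Fin.last (n + 1))) =
      Fin.init (Fin.init v) := by
    funext i
    simp [Fin.init]
  rw [h]
  simp

theorem subst {R : (Fin n → M) → M → Prop} {t : (Fin n → M) → M}
    (h : Dfn fun v : Fin (n + 1) → M => R (Fin.init v) (v (Fin.last n))) (ht : DfnFun t) :
    Dfn fun v => R v (t v) := by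
  have : (fun v => R v (t v)) = fun v => ∃ x, x = t v ∧ R v x := by simp
  rw [this]
  exact ex (and ht h)

theorem mem_proj (i j : Fin n) : Dfn fun v : Fin n → M => v i ∊ v j :=
  ⟨Relations.boundedFormula₂ (L := langMem) MemRel.mem
    (Term.var (Sum.inr i)) (Term.var (Sum.inr j)), fun v => by
      simp [Mem, BoundedFormula.realize_rel₂]⟩

theorem eq_proj (i j : Fin n) : Dfn fun v : Fin n → M => v i = v j :=
  ⟨Term.bdEqual (Term.var (Sum.inr i)) (Term.var (Sum.inr j)), fun v => by simp⟩

end Dfn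

theorem DfnFun.proj (i : Fin n) : DfnFun fun v : Fin n → M => v i :=
  Dfn.eq_proj (Fin.last n) i.castSucc

theorem DfnFun.const (c : M) : DfnFun fun _ : Fin n → M => c :=
  ⟨Term.bdEqual (Term.var (Sum.inr (Fin.last n))) (Term.var (Sum.inl c)), fun v => by simp⟩

theorem DfnFun.init {t : (Fin n → M) → M} (ht : DfnFun t) :
    DfnFun fun v : Fin (n + 1) → M => t (Fin.init v) :=
  Dfn.insert (R := fun v x => x = t v) ht

/-- A definable unary predicate. -/
def Dfn₁ (R : M → Prop) : Prop := Dfn fun v : Fin 1 → M => R (v 0)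

/-- A definable binary relation. -/
def Dfn₂ (R : M → M → Prop) : Prop := Dfn fun v : Fin 2 → M => R (v 0) (v 1)

theorem Dfn₂.subst {R : M → M → Prop} (hR : Dfn₂ R) {s t : (Fin n → M) → M}
    (hs : DfnFun s) (ht : DfnFun t) : Dfn fun v => R (s v) (t v) :=
  Dfn.subst (R := fun v x => R x (t v))
    (Dfn.subst (R := fun v x => R (v (Fin.last n)) x)
      (hR.reindex ![(Fin.last n).castSucc, Fin.last (n + 1)]) ht.init) hs

theorem Dfn₂.swap {R : M → M → Prop} (hR : Dfn₂ R) : Dfn₂ fun x y => R y x :=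
  hR.subst (.proj 1) (.proj 0)

theorem dfn_mem {s t : (Fin n → M) → M} (hs : DfnFun s) (ht : DfnFun t) :
    Dfn fun v => s v ∊ t v :=
  Dfn₂.subst (R := Mem) (Dfn.mem_proj 0 1) hs ht

theorem dfn_eq {s t : (Fin n → M) → M} (hs : DfnFun s) (ht : DfnFun t) :
    Dfn fun v => s v = t v :=
  Dfn₂.subst (R := fun x y => x = y) (Dfn.eq_proj 0 1) hs ht

/-- A definable function of one variable. -/
def DfnFun₁ (t : M → M) : Prop := DfnFun fun v : Fin 1 → M => t (v 0)

theorem DfnFun₁.dfn₂ {t : M → M} (ht : DfnFun₁ t) : Dfn₂ fun x y => y = t x := ht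

theorem DfnFun₁.comp {t : M → M} (ht : DfnFun₁ t) {s : (Fin n → M) → M} (hs : DfnFun s) :
    DfnFun fun v => t (s v) :=
  Dfn₂.subst (R := fun x y => y = t x) ht hs.init (.proj _)

end Definability

/-! ### The axioms of ZFA in semantic form -/

section Snoc

variable {M : Type*} {k : ℕ} (p : Fin k → M)

theorem snoc_snoc_eq_append (a b : M) :
    (Fin.snoc (α := fun _ => M) (Fin.snoc (α := fun _ => M) p a) b : Fin (k + 2) → M) =
      Fin.append p ![a, b] := by
  rw [show ![a, b] = Fin.snoc (α := fun _ => M) ![a] b by ext i; fin_cases i <;> rfl,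
    Fin.append_snoc, Fin.append_right_eq_snoc]
  rfl

theorem snoc_append₂ (a b c : M) :
    (Fin.snoc (α := fun _ => M) (Fin.append p ![a, b]) c : Fin (k + 3) → M) =
      Fin.append p ![a, b, c] := by
  rw [show ![a, b, c] = Fin.snoc (α := fun _ => M) ![a, b] c by ext i; fin_cases i <;> rfl,
    Fin.append_snoc]

theorem snoc_append₃ (a b c d : M) :
    (Fin.snoc (α := fun _ => M) (Fin.append p ![a, b, c]) d : Fin (k + 4) → M) =
      Fin.append p ![a, b, c, d] := by
  rw [show ![a, b, c, d] = Fin.snoc (α := fun _ => M) ![a, b, c] d by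
    ext i; fin_cases i <;> rfl, Fin.append_snoc]

theorem snoc_append₄ (a b c d e : M) :
    (Fin.snoc (α := fun _ => M) (Fin.append p ![a, b, c, d]) e : Fin (k + 5) → M) =
      Fin.append p ![a, b, c, d, e] := by
  rw [show ![a, b, c, d, e] = Fin.snoc (α := fun _ => M) ![a, b, c, d] e by
    ext i; fin_cases i <;> rfl, Fin.append_snoc]

end Snoc

section Realize

variable {M : Type*} [langMem.Structure M] {n : ℕ}

local infix:50 " ∊ " => Mem

/-- `z = {x, y}`. -/
def IsPair (x y z : M) : Prop := ∀ t, t ∊ z ↔ t = x ∨ t = y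

/-- `p` is the Kuratowski pair of `x` and `y`. -/
def IsOPair (x y p : M) : Prop := ∃ u w, IsPair x x u ∧ IsPair x y w ∧ IsPair u w p

/-- `(x, y) ∈ f`. -/
def App (f x y : M) : Prop := ∃ p, IsOPair x y p ∧ p ∊ f

/-- `f` is a function with domain `X`. -/
def IsFun (f X : M) : Prop :=
  (∀ p, p ∊ f → ∃ x y, x ∊ X ∧ IsOPair x y p) ∧ ∀ x, x ∊ X → ∃ y, ∀ z, App f x z ↔ z = y

/-- `S` codes a flat system with indeterminates `X` and constants from `A`. -/
def IsFlatSystem (X A S : M) : Prop :=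
  IsFun S X ∧ ∀ x s, App S x s → ∀ z, z ∊ s → z ∊ X ∨ z ∊ A

/-- `f` solves the flat system `S` with indeterminates `X`. -/
def IsSolution (X S f : M) : Prop :=
  IsFun f X ∧ ∀ x s v, App S x s ∧ App f x v →
    ∀ z, z ∊ v ↔ (∃ y, y ∊ s ∧ y ∊ X ∧ App f y z) ∨ z ∊ s ∧ ¬ z ∊ X

theorem realize_opairF (x y p : Fin n) (v : Empty → M) (xs : Fin n → M) :
    (opairF x y p).Realize v xs ↔ IsOPair (xs x) (xs y) (xs p) := by
  simp [opairF, realize_pairF, IsOPair, IsPair]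

theorem realize_appF (f x y : Fin n) (v : Empty → M) (xs : Fin n → M) :
    (appF f x y).Realize v xs ↔ App (xs f) (xs x) (xs y) := by
  simp [appF, realize_opairF, realize_memF, App]

theorem realize_funF (f X : Fin n) (v : Empty → M) (xs : Fin n → M) :
    (funF f X).Realize v xs ↔ IsFun (xs f) (xs X) := by
  have h1 (xs : Fin n → M) (a b c : M) :
      Fin.snoc (α := fun _ => M) (Fin.snoc (α := fun _ => M) (Fin.snoc (α := fun _ => M) xs a) b) c
        (Fin.last (n + 2)) = c := Fin.snoc_last ..
  have h2 (xs : Fin n → M) (a b : M) :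
      Fin.snoc (α := fun _ => M) (Fin.snoc (α := fun _ => M) xs a) b
        (Fin.last (n + 1)) = b := Fin.snoc_last ..
  simp [funF, realize_opairF, realize_memF, realize_appF, realize_eqF, IsFun, h1, h2]

theorem realize_flatSystemF (X A S : Fin n) (v : Empty → M) (xs : Fin n → M) :
    (flatSystemF X A S).Realize v xs ↔ IsFlatSystem (xs X) (xs A) (xs S) := by
  have h1 (xs : Fin n → M) (a b c : M) :
      Fin.snoc (α := fun _ => M) (Fin.snoc (α := fun _ => M) (Fin.snoc (α := fun _ => M) xs a) b) c
        (Fin.last (n + 2)) = c := Fin.snoc_last ..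
  have h2 (xs : Fin n → M) (a b : M) :
      Fin.snoc (α := fun _ => M) (Fin.snoc (α := fun _ => M) xs a) b
        (Fin.last (n + 1)) = b := Fin.snoc_last ..
  simp [flatSystemF, realize_funF, realize_memF, realize_appF, IsFlatSystem, h1, h2]

theorem realize_solutionF (X S f : Fin n) (v : Empty → M) (xs : Fin n → M) :
    (solutionF X S f).Realize v xs ↔ IsSolution (xs X) (xs S) (xs f) := by
  simp [solutionF, realize_funF, realize_memF, realize_appF, IsSolution,
    snoc_snoc_eq_append, snoc_append₂, snoc_append₃, snoc_append₄, Fin.append_left, Fin.append_right]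

theorem realize_substF {α : Type} (φ : langMem.Formula α) (g : α → Fin n) (v : Empty → M)
    (xs : Fin n → M) : (substF φ g).Realize v xs ↔ φ.Realize (xs ∘ g) := by
  rw [substF, BoundedFormula.realize_relabel, Formula.Realize]
  exact iff_of_eq (congrArg₂ _ (by ext; simp) (Subsingleton.elim _ _))

/-- A definable relation is defined by a formula with finitely many parameters. -/
theorem Dfn.exists_formula {P : (Fin n → M) → Prop} (hP : Dfn P) :
    ∃ (k : ℕ) (p : Fin k → M) (φ : langMem.Formula (Fin k ⊕ Fin n)),
      ∀ v, P v ↔ φ.Realize (Sum.elim p v) := by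
  classical
  obtain ⟨φ, hφ⟩ := hP
  let e := φ.freeVarFinset.equivFin
  refine ⟨_, fun i => (e.symm i : M), (φ.restrictFreeVar e).toFormula, fun v => ?_⟩
  rw [hφ, BoundedFormula.realize_toFormula]
  exact (BoundedFormula.realize_restrictFreeVar id (by simp)).symm

theorem realize_extensionality (h : M ⊨ extensionality) :
    ∀ x y : M, (∀ z, z ∊ x ↔ z ∊ y) → x = y := by
  simpa [extensionality, Sentence.Realize, Formula.Realize, realize_memF, realize_eqF, Fin.snoc]
    using h

theorem realize_pairing (h : M ⊨ pairing) : ∀ x y : M, ∃ p, IsPair x y p := by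
  simpa [pairing, Sentence.Realize, Formula.Realize, realize_pairF, Fin.snoc, IsPair] using h

theorem realize_union (h : M ⊨ union) :
    ∀ x : M, ∃ u, ∀ z, z ∊ u ↔ ∃ y, y ∊ x ∧ z ∊ y := by
  simpa [union, Sentence.Realize, Formula.Realize, realize_memF, Fin.snoc] using h

theorem realize_antiFoundation (h : M ⊨ antiFoundation) :
    ∀ X A S : M, IsFlatSystem X A S → ∃ f, IsSolution X S f := by
  have : ∀ X A S : M, IsFlatSystem X A S → ∃ f, ∀ g, IsSolution X S g ↔ g = f := by
    simpa [antiFoundation, Sentence.Realize, Formula.Realize, realize_flatSystemF,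
      realize_solutionF, realize_eqF, Fin.snoc] using h
  intro X A S hS
  obtain ⟨f, hf⟩ := this X A S hS
  exact ⟨f, (hf f).2 rfl⟩

theorem realize_separation (h : ∀ k φ, M ⊨ separation k φ) {Q : M → Prop} (hQ : Dfn₁ Q) (a : M) :
    ∃ b, ∀ z, z ∊ b ↔ z ∊ a ∧ Q z := by
  obtain ⟨k, p, φ, hφ⟩ := Dfn.exists_formula hQ
  have := h k φ
  rw [separation, Sentence.Realize, BoundedFormula.realize_alls] at this
  have h2 := this p
  simp only [BoundedFormula.realize_all, BoundedFormula.realize_ex, BoundedFormula.realize_iff,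
    BoundedFormula.realize_inf, realize_memF, realize_substF] at h2
  obtain ⟨b, hb⟩ := h2 a
  refine ⟨b, fun z => ?_⟩
  have hz := hb z
  simp only [snoc_snoc_eq_append, snoc_append₂, Fin.append_right] at hz
  rw [show Fin.append p ![a, b, z] ∘ Sum.elim (Fin.castAdd 3) ![Fin.natAdd k (2 : Fin 3)] =
      Sum.elim p ![z] by ext (i | i) <;> simp, ← hφ ![z] ] at hz
  exact hz

theorem realize_replacement (h : ∀ k φ, M ⊨ replacement k φ) {R : M → M → Prop} (hR : Dfn₂ R)
    (a : M) (ha : ∀ x, x ∊ a → ∃ y, ∀ z, R x z ↔ z = y) :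
    ∃ b, ∀ y, y ∊ b ↔ ∃ x, x ∊ a ∧ R x y := by
  obtain ⟨k, p, φ, hφ⟩ := Dfn.exists_formula hR
  have := h k φ
  rw [replacement, Sentence.Realize, BoundedFormula.realize_alls] at this
  have h2 := this p
  simp only [BoundedFormula.realize_all, BoundedFormula.realize_ex, BoundedFormula.realize_iff,
    BoundedFormula.realize_imp, BoundedFormula.realize_inf, realize_memF, realize_substF,
    realize_eqF] at h2
  have hφ' (x y : M) : R x y ↔ φ.Realize (Sum.elim p ![x, y]) := hφ ![x, y]
  simp only [snoc_snoc_eq_append, snoc_append₂, snoc_append₃, Fin.append_right] at h2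
  have h3 (x y z w : M) : Fin.append p ![x, y, z, w] ∘
      Sum.elim (Fin.castAdd 4) ![Fin.natAdd k (1 : Fin 4), Fin.natAdd k (3 : Fin 4)] =
        Sum.elim p ![y, w] := by
    ext (i | i)
    · simp
    · fin_cases i <;> simp
  have h4 (x y z w : M) : Fin.append p ![x, y, z, w] ∘
      Sum.elim (Fin.castAdd 4) ![Fin.natAdd k (3 : Fin 4), Fin.natAdd k (2 : Fin 4)] =
        Sum.elim p ![w, z] := by
    ext (i | i)
    · simp
    · fin_cases i <;> simp
  simp only [h3, h4, ← hφ'] at h2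
  obtain ⟨b, hb⟩ := h2 a ha
  exact ⟨b, hb⟩

variable (M) in
/-- The axioms of ZFA which the argument uses. Of Anti-Foundation only the existence of solutions
is needed. -/
class SetAxioms : Prop where
  nonempty : Nonempty M
  ext : ∀ x y : M, (∀ z, z ∊ x ↔ z ∊ y) → x = y
  pair : ∀ x y : M, ∃ p, IsPair x y p
  union : ∀ x : M, ∃ u, ∀ z, z ∊ u ↔ ∃ y, y ∊ x ∧ z ∊ y
  sep : ∀ {Q : M → Prop}, Dfn₁ Q → ∀ a : M, ∃ b, ∀ z, z ∊ b ↔ z ∊ a ∧ Q z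
  repl : ∀ {R : M → M → Prop}, Dfn₂ R → ∀ a : M, (∀ x, x ∊ a → ∃ y, ∀ z, R x z ↔ z = y) →
    ∃ b, ∀ y, y ∊ b ↔ ∃ x, x ∊ a ∧ R x y
  solution : ∀ X A S : M, IsFlatSystem X A S → ∃ f, IsSolution X S f

theorem setAxioms_of_model (h : M ⊨ ZFA) : SetAxioms M := by
  have ax {σ : langMem.Sentence} (hσ : σ ∈ ZFA) : M ⊨ σ := h.realize_of_mem σ hσ
  refine ⟨?_, realize_extensionality (ax (by simp [ZFA])), realize_pairing (ax (by simp [ZFA])),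
    realize_union (ax (by simp [ZFA])), realize_separation fun k φ => ax ?_,
    realize_replacement fun k φ => ax ?_, realize_antiFoundation (ax (by simp [ZFA]))⟩
  · have := ax (σ := infinity) (by simp [ZFA])
    rw [infinity, Sentence.Realize, Formula.Realize, BoundedFormula.realize_ex] at this
    exact ⟨this.choose⟩
  · exact Or.inl (Or.inr ⟨k, φ, rfl⟩)
  · exact Or.inr ⟨k, φ, rfl⟩

end Realize

/-! ### Sets and functions inside a model -/

section Sets

variable {M : Type*} [langMem.Structure M] [SetAxioms M] {n : ℕ}

local infix:50 " ∊ " => Mem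

instance SetAxioms.instNonempty : Nonempty M := SetAxioms.nonempty

open Classical in
/-- The set of all `z` with `Q z`; an unspecified fixed element if there is no such set. -/
noncomputable def coll (Q : M → Prop) : M :=
  if h : ∃ b, ∀ z, z ∊ b ↔ Q z then h.choose else Classical.arbitrary M

theorem mem_coll {Q : M → Prop} (h : ∃ b, ∀ z, z ∊ b ↔ Q z) (z : M) : z ∊ coll Q ↔ Q z := by
  rw [coll, dif_pos h]
  exact h.choose_spec z

theorem eq_coll_iff {Q : M → Prop} (y : M) :
    y = coll Q ↔ (∀ z, z ∊ y ↔ Q z) ∨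
      (¬ ∃ b, ∀ z, z ∊ b ↔ Q z) ∧ y = Classical.arbitrary M := by
  by_cases h : ∃ b, ∀ z, z ∊ b ↔ Q z
  · simp only [h, not_true_eq_false, false_and, or_false]
    constructor
    · rintro rfl
      exact mem_coll h
    · intro hy
      exact SetAxioms.ext _ _ fun z => (hy z).trans (mem_coll h z).symm
  · have : ¬ ∀ z, z ∊ y ↔ Q z := fun hy => h ⟨y, hy⟩
    simp [coll, this, h]

/-- Even where `coll` takes its unspecified value it is definable, as the existence of the set is
expressible. -/
theorem DfnFun.coll {R : (Fin n → M) → M → Prop}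
    (h : Dfn fun v : Fin (n + 1) → M => R (Fin.init v) (v (Fin.last n))) :
    DfnFun fun v => coll (R v) := by
  have h' := h.insert
  have h'' := Dfn.insert (R := fun v z => R (Fin.init v) z) h'
  unfold DfnFun
  simp only [eq_coll_iff]
  refine .or (.all (.iff (dfn_mem (.proj _) (DfnFun.proj (Fin.last n)).init) h'))
    (.and (.not (.ex (.all (.iff (dfn_mem (.proj _) (DfnFun.proj (Fin.last _)).init) h''))))
      (dfn_eq (.proj _) (.const _)))

theorem mem_coll_of_subset {Q : M → Prop} (hQ : Dfn₁ Q) (a : M) (h : ∀ z, Q z → z ∊ a) (z : M) :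
    z ∊ coll Q ↔ Q z := by
  refine mem_coll ?_ z
  obtain ⟨b, hb⟩ := SetAxioms.sep hQ a
  exact ⟨b, fun z => (hb z).trans ⟨And.right, fun hz => ⟨h z hz, hz⟩⟩⟩

/-- The unordered pair. -/
noncomputable def pr (x y : M) : M := coll fun z => z = x ∨ z = y

theorem mem_pr {x y z : M} : z ∊ pr x y ↔ z = x ∨ z = y := mem_coll (SetAxioms.pair x y) z

theorem isPair_iff {x y z : M} : IsPair x y z ↔ z = pr x y :=
  ⟨fun h => SetAxioms.ext _ _ fun t => (h t).trans mem_pr.symm, by rintro rfl t; exact mem_pr⟩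

theorem DfnFun.pr {s t : (Fin n → M) → M} (hs : DfnFun s) (ht : DfnFun t) :
    DfnFun fun v => pr (s v) (t v) :=
  .coll (R := fun v z => z = s v ∨ z = t v)
    (.or (dfn_eq (.proj _) hs.init) (dfn_eq (.proj _) ht.init))

theorem pr_eq_pr {a b c d : M} (h : pr a b = pr c d) : a = c ∧ b = d ∨ a = d ∧ b = c := by
  have h1 : a = c ∨ a = d := by rw [← mem_pr, ← h, mem_pr]; simp
  have h2 : b = c ∨ b = d := by rw [← mem_pr, ← h, mem_pr]; simp
  have h3 : c = a ∨ c = b := by rw [← mem_pr, h, mem_pr]; simp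
  have h4 : d = a ∨ d = b := by rw [← mem_pr, h, mem_pr]; simp
  grind

theorem pr_right_injective {a b c : M} (h : pr a b = pr a c) : b = c := by
  have := pr_eq_pr h
  grind

/-- The Kuratowski pair. -/
noncomputable def opair (x y : M) : M := pr (pr x x) (pr x y)

theorem isOPair_iff {x y p : M} : IsOPair x y p ↔ p = opair x y := by
  simp [IsOPair, isPair_iff, opair]

theorem opair_inj {a b c d : M} : opair a b = opair c d ↔ a = c ∧ b = d := by
  refine ⟨fun h => ?_, by rintro ⟨rfl, rfl⟩; rfl⟩
  rcases pr_eq_pr h with ⟨h1, h2⟩ | ⟨h1, h2⟩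
  · have := pr_eq_pr h1
    have := pr_eq_pr h2
    grind
  · have := pr_eq_pr h1
    have := pr_eq_pr h2
    grind

theorem app_iff {f x y : M} : App f x y ↔ opair x y ∊ f := by
  simp [App, isOPair_iff]

theorem DfnFun.opair {s t : (Fin n → M) → M} (hs : DfnFun s) (ht : DfnFun t) :
    DfnFun fun v => opair (s v) (t v) :=
  .pr (.pr hs hs) (.pr hs ht)

/-- The union `⋃ a`. -/
noncomputable def sUnion (a : M) : M := coll fun z => ∃ y, y ∊ a ∧ z ∊ y

theorem mem_sUnion {a z : M} : z ∊ sUnion a ↔ ∃ y, y ∊ a ∧ z ∊ y := mem_coll (SetAxioms.union a) z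

/-- The union `a ∪ b`. -/
noncomputable def cup (a b : M) : M := sUnion (pr a b)

theorem mem_cup {a b z : M} : z ∊ cup a b ↔ z ∊ a ∨ z ∊ b := by
  simp [cup, mem_sUnion, mem_pr]

/-- The image `t[a]` of a set under a function. -/
noncomputable def image (t : M → M) (a : M) : M := coll fun y => ∃ x, x ∊ a ∧ y = t x

theorem mem_image {t : M → M} (ht : DfnFun₁ t) {a y : M} :
    y ∊ image t a ↔ ∃ x, x ∊ a ∧ y = t x :=
  mem_coll (SetAxioms.repl ht.dfn₂ a fun x _ => ⟨t x, fun _ => Iff.rfl⟩) y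

/-- Russell's argument for `2`-cycles instead of loops: outside of every set `a` there is some `p`
which, in addition, lies on no membership cycle of length at most two. -/
theorem exists_fresh (a : M) : ∃ p, ¬ p ∊ a ∧ ∀ t, p ∊ t → ¬ t ∊ p := by
  have hQ : Dfn₁ fun u : M => ∀ t, u ∊ t → ¬ t ∊ u := by
    refine .all (.imp (dfn_mem (DfnFun.proj 0).init (.proj _))
      (.not (dfn_mem (.proj _) (DfnFun.proj 0).init)))
  obtain ⟨p, hp⟩ := SetAxioms.sep hQ a
  have h : ∀ t, p ∊ t → ¬ t ∊ p := fun t h1 h2 => ((hp t).1 h2).2 p h2 h1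
  exact ⟨p, fun hpa => h p ((hp p).2 ⟨hpa, h⟩) ((hp p).2 ⟨hpa, h⟩), h⟩

/-- The function `{(h u, k u) : u ∈ G}`, where `h` is injective on `G`. -/
theorem isFun_image {h k : M → M} (hh : DfnFun₁ h) (hk : DfnFun₁ k) {G : M}
    (hinj : ∀ u v, u ∊ G → v ∊ G → h u = h v → u = v) :
    IsFun (image (fun u => opair (h u) (k u)) G) (image h G) ∧
      ∀ u, u ∊ G → ∀ y, App (image (fun u => opair (h u) (k u)) G) (h u) y ↔ y = k u := by
  have hd : DfnFun₁ fun u => opair (h u) (k u) := DfnFun.opair hh hk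
  have happ : ∀ u, u ∊ G → ∀ y,
      App (image (fun u => opair (h u) (k u)) G) (h u) y ↔ y = k u := by
    intro u hu y
    rw [app_iff, mem_image hd]
    simp only [opair_inj]
    constructor
    · rintro ⟨x, hx, h1, h2⟩
      rw [h2, hinj u x hu hx h1]
    · rintro rfl
      exact ⟨u, hu, rfl, rfl⟩
  refine ⟨⟨fun p hp => ?_, fun x hx => ?_⟩, happ⟩
  · obtain ⟨u, hu, rfl⟩ := (mem_image hd).1 hp
    exact ⟨h u, k u, (mem_image hh).2 ⟨u, hu, rfl⟩, isOPair_iff.2 rfl⟩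
  · obtain ⟨u, hu, rfl⟩ := (mem_image hh).1 hx
    exact ⟨k u, happ u hu⟩

/-- Anti-Foundation without indeterminates: every set `G` has a decoration in which `g u` consists
of the `g u'` with `u' ∈ u` in `G` and of prescribed further elements from a set `C`. -/
theorem exists_decoration (G C : M) {T : M → M → Prop} (hT : Dfn₂ T)
    (hC : ∀ u z, u ∊ G → T u z → z ∊ C) :
    ∃ g : M → M, DfnFun₁ g ∧ ∀ u, u ∊ G → ∀ z,
      z ∊ g u ↔ (∃ u', u' ∊ G ∧ u' ∊ u ∧ z = g u') ∨ T u z := by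
  -- The indeterminate for `u` is `{q, u}`, where `q` keeps it out of `C`.
  obtain ⟨q, hq, -⟩ := exists_fresh (sUnion C)
  let h : M → M := fun u => pr q u
  have hh : DfnFun₁ h := DfnFun.pr (.const q) (.proj 0)
  have hhC (u : M) : ¬ h u ∊ C := fun hu => hq (mem_sUnion.2 ⟨h u, hu, mem_pr.2 (Or.inl rfl)⟩)
  have hinj : ∀ u v, h u = h v → u = v := fun u v => pr_right_injective
  have hX (z : M) : z ∊ image h G ↔ ∃ u, u ∊ G ∧ z = h u := mem_image hh
  let k : M → M := fun u => coll fun z => (∃ u', u' ∊ G ∧ u' ∊ u ∧ z = h u') ∨ z ∊ C ∧ T u z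
  have hk : DfnFun₁ k := by
    refine .coll (R := fun v z => (∃ u', u' ∊ G ∧ u' ∊ v 0 ∧ z = h u') ∨ z ∊ C ∧ T (v 0) z)
      (.or (.ex ?_) ?_)
    · exact .and (dfn_mem (.proj _) (.const G)) (.and (dfn_mem (.proj _) (DfnFun.proj 0).init.init)
        (dfn_eq (DfnFun.proj (Fin.last _)).init (hh.comp (.proj _))))
    · exact .and (dfn_mem (.proj _) (.const C)) (hT.subst (DfnFun.proj 0).init (.proj _))
  have mem_k (u z : M) :
      z ∊ k u ↔ (∃ u', u' ∊ G ∧ u' ∊ u ∧ z = h u') ∨ z ∊ C ∧ T u z := by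
    refine mem_coll_of_subset (Q := fun z => (∃ u', u' ∊ G ∧ u' ∊ u ∧ z = h u') ∨ z ∊ C ∧ T u z)
      (.or (.ex ?_) ?_) (cup (image h G) C) ?_ z
    · exact .and (dfn_mem (.proj _) (.const G)) (.and (dfn_mem (.proj _) (.const u))
        (dfn_eq (DfnFun.proj 0).init (hh.comp (.proj _))))
    · exact .and (dfn_mem (.proj 0) (.const C)) (hT.subst (.const u) (.proj 0))
    · rintro z (⟨u', h1, -, rfl⟩ | ⟨hz, -⟩)
      · exact mem_cup.2 (Or.inl ((hX _).2 ⟨u', h1, rfl⟩))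
      · exact mem_cup.2 (Or.inr hz)
  obtain ⟨hfun, happ⟩ := isFun_image hh hk (G := G) fun u v _ _ => hinj u v
  set S := image (fun u => opair (h u) (k u)) G
  obtain ⟨f, hf, hsol⟩ := SetAxioms.solution (image h G) C S ⟨hfun, by
    intro x s hs z hz
    obtain ⟨p, hp, hpS⟩ := hs
    obtain ⟨x', y', hx', hp'⟩ := hfun.1 p hpS
    rw [isOPair_iff] at hp hp'
    obtain ⟨rfl, rfl⟩ := opair_inj.1 (hp.symm.trans hp')
    obtain ⟨u, hu, rfl⟩ := (hX _).1 hx'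
    rw [(happ u hu s).1 ⟨p, isOPair_iff.2 hp, hpS⟩, mem_k] at hz
    rcases hz with ⟨u', h1, -, rfl⟩ | ⟨hz, -⟩
    · exact Or.inl ((hX _).2 ⟨u', h1, rfl⟩)
    · exact Or.inr hz⟩
  let g : M → M := fun u => coll fun z => ∃ y, opair (h u) y ∊ f ∧ z ∊ y
  have hg : DfnFun₁ g := by
    refine .coll (R := fun v z => ∃ y, opair (h (v 0)) y ∊ f ∧ z ∊ y) (.ex (.and ?_ ?_))
    · exact dfn_mem (.opair (hh.comp (DfnFun.proj 0).init.init) (.proj _)) (.const f)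
    · exact dfn_mem (DfnFun.proj (Fin.last _)).init (.proj _)
  have app_f (u : M) (hu : u ∊ G) (y : M) : App f (h u) y ↔ y = g u := by
    obtain ⟨y₀, hy₀⟩ := hf.2 (h u) ((hX _).2 ⟨u, hu, rfl⟩)
    have hiff (z : M) : (∃ y, opair (h u) y ∊ f ∧ z ∊ y) ↔ z ∊ y₀ := by
      simp only [← app_iff, hy₀]
      simp
    have : g u = y₀ := SetAxioms.ext _ _ fun z =>
      (mem_coll ⟨y₀, fun z => (hiff z).symm⟩ z).trans (hiff z)
    rw [this, hy₀]
  refine ⟨g, hg, fun u hu z => ?_⟩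
  rw [hsol (h u) (k u) (g u) ⟨(happ u hu _).2 rfl, (app_f u hu _).2 rfl⟩ z]
  refine or_congr ⟨?_, ?_⟩ ⟨?_, ?_⟩
  · rintro ⟨y, hy, hyX, hyz⟩
    obtain ⟨u', hu', rfl⟩ := (hX _).1 hyX
    rcases (mem_k _ _).1 hy with ⟨u'', -, h2, h3⟩ | ⟨hC, -⟩
    · obtain rfl := hinj _ _ h3
      exact ⟨u', hu', h2, (app_f u' hu' z).1 hyz⟩
    · exact absurd hC (hhC u')
  · rintro ⟨u', hu', h2, rfl⟩
    exact ⟨h u', (mem_k _ _).2 (Or.inl ⟨u', hu', h2, rfl⟩), (hX _).2 ⟨u', hu', rfl⟩,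
      (app_f u' hu' _).2 rfl⟩
  · rintro ⟨hz, hzX⟩
    rcases (mem_k _ _).1 hz with ⟨u', hu', -, h3⟩ | ⟨-, hT'⟩
    · exact absurd ((hX _).2 ⟨u', hu', h3⟩) hzX
    · exact hT'
  · intro hz
    refine ⟨(mem_k _ _).2 (Or.inr ⟨hC u z hu hz, hz⟩), fun hzX => ?_⟩
    obtain ⟨u', -, rfl⟩ := (hX _).1 hzX
    exact hhC u' (hC u _ hu hz)

/-- Every set `G` has an isomorphic copy, disjoint from a given set `A`, which is closed under
double-membership, such that no element of the copy belongs to an element of `A` and such that it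
is prescribed by `P` which elements of `A` belong to the copy of `u ∈ G`. -/
theorem exists_copy (G A : M) {P : M → M → Prop} (hP : Dfn₂ P) :
    ∃ g : M → M, DfnFun₁ g ∧
      (∀ u v, u ∊ G → v ∊ G → g u = g v → u = v) ∧
      (∀ u v, u ∊ G → v ∊ G → (g u ∊ g v ↔ u ∊ v)) ∧
      (∀ u, u ∊ G → ¬ g u ∊ A) ∧
      (∀ u a, u ∊ G → a ∊ A → (a ∊ g u ↔ P u a)) ∧
      (∀ u a, u ∊ G → a ∊ A → ¬ g u ∊ a) ∧
      ∀ u z, u ∊ G → z ∊ g u → g u ∊ z → ∃ v, v ∊ G ∧ z = g v := by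
  -- The element `{p, u}` of `g u` makes `g` injective and keeps `g u` away from `A` and `G`.
  let W := cup A G
  obtain ⟨p, hp, hpc⟩ :=
    exists_fresh (cup (sUnion W) (cup (sUnion (sUnion W)) (sUnion (sUnion (sUnion W)))))
  simp only [mem_cup, mem_sUnion, not_or, not_exists, not_and] at hp
  obtain ⟨hp1, hp2, hp3⟩ := hp
  have hA {a : M} (ha : a ∊ A) : a ∊ W := mem_cup.2 (Or.inl ha)
  have hG {a : M} (ha : a ∊ G) : a ∊ W := mem_cup.2 (Or.inr ha)
  let h : M → M := fun u => pr p u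
  have hh : DfnFun₁ h := DfnFun.pr (.const p) (.proj 0)
  have ph (u : M) : p ∊ h u := mem_pr.2 (Or.inl rfl)
  have hT : Dfn₂ fun u z => z ∊ A ∧ P u z ∨ z = h u :=
    .or (.and (dfn_mem (.proj 1) (.const A)) hP) hh.dfn₂
  obtain ⟨g, hg, mem_g⟩ := exists_decoration G (cup A (image h G)) hT (by
    rintro u z hu (⟨hz, -⟩ | rfl)
    · exact mem_cup.2 (Or.inl hz)
    · exact mem_cup.2 (Or.inr ((mem_image hh).2 ⟨u, hu, rfl⟩)))
  have hgh (u : M) (hu : u ∊ G) : h u ∊ g u := (mem_g u hu _).2 (Or.inr (Or.inr rfl))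
  have notA (u : M) (hu : u ∊ G) : ¬ g u ∊ A := fun ha =>
    hp2 (h u) ⟨g u, hA ha, hgh u hu⟩ (ph u)
  have notMemA (u a : M) (hu : u ∊ G) (ha : a ∊ A) : ¬ g u ∊ a := fun hga =>
    hp3 (h u) ⟨g u, ⟨a, hA ha, hga⟩, hgh u hu⟩ (ph u)
  have hNotA (u : M) : ¬ h u ∊ A := fun ha => hp1 (h u) (hA ha) (ph u)
  have gNeH (u v : M) (hu : u ∊ G) (hv : v ∊ G) : g u ≠ h v := by
    intro e
    have : h u ∊ h v := e ▸ hgh u hu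
    rcases mem_pr.1 this with h1 | h1
    · have := ph u
      rw [h1] at this
      exact hpc p this this
    · exact hp1 v (hG hv) (h1 ▸ ph u)
  have inj (u v : M) (hu : u ∊ G) (hv : v ∊ G) (e : g u = g v) : u = v := by
    have : h u ∊ g v := e ▸ hgh u hu
    rcases (mem_g v hv _).1 this with ⟨w, hw, -, h1⟩ | ⟨h1, -⟩ | h1
    · exact absurd h1.symm (gNeH w u hw hu)
    · exact absurd h1 (hNotA u)
    · exact pr_right_injective h1
  refine ⟨g, hg, inj, fun u v hu hv => ?_, notA, fun u a hu ha => ?_, notMemA,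
    fun u z hu h1 h2 => ?_⟩
  · rw [mem_g v hv]
    constructor
    · rintro (⟨w, hw, h1, h2⟩ | ⟨h1, -⟩ | h1)
      · rwa [inj u w hu hw h2]
      · exact absurd h1 (notA u hu)
      · exact absurd h1 (gNeH u v hu hv)
    · intro h1
      exact Or.inl ⟨u, hu, h1, rfl⟩
  · rw [mem_g u hu]
    constructor
    · rintro (⟨w, hw, -, rfl⟩ | ⟨-, h1⟩ | rfl)
      · exact absurd ha (notA w hw)
      · exact h1
      · exact absurd ha (hNotA u)
    · intro h1
      exact Or.inr (Or.inl ⟨ha, h1⟩)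
  · rcases (mem_g u hu z).1 h1 with ⟨w, hw, -, h3⟩ | ⟨h3, -⟩ | rfl
    · exact ⟨w, hw, h3⟩
    · exact absurd h2 (notMemA u z hu h3)
    · rcases mem_pr.1 h2 with h4 | h4
      · exact absurd (h4 ▸ hgh u hu) (hpc _ (ph u))
      · have h5 := hgh u hu
        rw [h4] at h5
        exact absurd (ph u) (hp2 (h u) ⟨u, hG hu, h5⟩)

end Sets

/-! ### Balls for double-membership and local isomorphisms -/

section Balls

variable {M : Type*} [langMem.Structure M]

local infix:50 " ∊ " => Mem

/-- `x ∈ y` or `y ∈ x`. -/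
def Single (x y : M) : Prop := x ∊ y ∨ y ∊ x

/-- `x ∈ y` and `y ∈ x`. -/
def Double (x y : M) : Prop := x ∊ y ∧ y ∊ x

theorem Double.symm {x y : M} (h : Double x y) : Double y x := And.symm h

theorem single_comm {x y : M} : Single x y ↔ Single y x := or_comm

theorem double_comm {x y : M} : Double x y ↔ Double y x := and_comm

/-- `F` is the graph of an isomorphism from `U` to `V` for the two relations of the SD-graph, and it
is definable in `M` with parameters. -/
structure PartialIso (F : M → M → Prop) (U V : M) : Prop where
  dfn : Dfn₂ F
  dom : ∀ {x y}, F x y → x ∊ U ∧ y ∊ V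
  total : ∀ {x}, x ∊ U → ∃ y, F x y
  surj : ∀ {y}, y ∊ V → ∃ x, F x y
  eq_iff : ∀ {x y x' y'}, F x y → F x' y' → (x = x' ↔ y = y')
  single_iff : ∀ {x y x' y'}, F x y → F x' y' → (Single x x' ↔ Single y y')
  double_iff : ∀ {x y x' y'}, F x y → F x' y' → (Double x x' ↔ Double y y')

namespace PartialIso

variable {F : M → M → Prop} {U V : M}

theorem symm (h : PartialIso F U V) : PartialIso (fun x y => F y x) V U where
  dfn := h.dfn.swap
  dom hxy := (h.dom hxy).symm
  total := h.surj
  surj := h.total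
  eq_iff h1 h2 := (h.eq_iff h1 h2).symm
  single_iff h1 h2 := (h.single_iff h1 h2).symm
  double_iff h1 h2 := (h.double_iff h1 h2).symm

theorem refl (U : M) : PartialIso (fun x y => x ∊ U ∧ x = y) U U where
  dfn := .and (dfn_mem (.proj 0) (.const U)) (dfn_eq (.proj 0) (.proj 1))
  dom := by rintro x _ ⟨hx, rfl⟩; exact ⟨hx, hx⟩
  total hx := ⟨_, hx, rfl⟩
  surj hx := ⟨_, hx, rfl⟩
  eq_iff := by rintro x _ x' _ ⟨-, rfl⟩ ⟨-, rfl⟩; rfl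
  single_iff := by rintro x _ x' _ ⟨-, rfl⟩ ⟨-, rfl⟩; rfl
  double_iff := by rintro x _ x' _ ⟨-, rfl⟩ ⟨-, rfl⟩; rfl

/-- The restriction of an isomorphism to subsets which correspond to each other. -/
theorem restrict (h : PartialIso F U V) {U' V' : M} (hU : ∀ x, x ∊ U' → x ∊ U)
    (hV : ∀ y, y ∊ V' → y ∊ V) (hUV : ∀ {x y}, F x y → (x ∊ U' ↔ y ∊ V')) :
    PartialIso (fun x y => F x y ∧ x ∊ U') U' V' where
  dfn := .and h.dfn (dfn_mem (.proj 0) (.const U'))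
  dom hxy := ⟨hxy.2, (hUV hxy.1).1 hxy.2⟩
  total hx := by
    obtain ⟨y, hy⟩ := h.total (hU _ hx)
    exact ⟨y, hy, hx⟩
  surj hy := by
    obtain ⟨x, hx⟩ := h.surj (hV _ hy)
    exact ⟨x, hx, (hUV hx).2 hy⟩
  eq_iff h1 h2 := h.eq_iff h1.1 h2.1
  single_iff h1 h2 := h.single_iff h1.1 h2.1
  double_iff h1 h2 := h.double_iff h1.1 h2.1

end PartialIso

variable [SetAxioms M] {n : ℕ}

/-- The set of all points at distance at most `r` from the set `A` for double-membership. The radius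
is an actual natural number, whatever the natural numbers of `M` look like. -/
noncomputable def ball : ℕ → M → M
  | 0, A => A
  | r + 1, A => cup (ball r A) (coll fun z => ∃ y, y ∊ ball r A ∧ Double y z)

theorem mem_ball_succ {r : ℕ} {A z : M} :
    z ∊ ball (r + 1) A ↔ z ∊ ball r A ∨ ∃ y, y ∊ ball r A ∧ Double y z := by
  rw [ball, mem_cup, mem_coll_of_subset _ (sUnion (ball r A))]
  · rintro z ⟨y, hy, -, hzy⟩
    exact mem_sUnion.2 ⟨y, hy, hzy⟩
  · exact .ex (.and (dfn_mem (.proj _) (.const _))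
      (.and (dfn_mem (.proj _) (DfnFun.proj 0).init) (dfn_mem (DfnFun.proj 0).init (.proj _))))

theorem ball_succ_of_mem {r : ℕ} {A z : M} (h : z ∊ ball r A) : z ∊ ball (r + 1) A :=
  mem_ball_succ.2 (Or.inl h)

theorem ball_succ_of_double {r : ℕ} {A y z : M} (h : y ∊ ball r A) (hd : Double y z) :
    z ∊ ball (r + 1) A :=
  mem_ball_succ.2 (Or.inr ⟨y, h, hd⟩)

theorem ball_mono_radius {r s : ℕ} (hrs : r ≤ s) {A z : M} (h : z ∊ ball r A) : z ∊ ball s A := by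
  induction hrs with
  | refl => exact h
  | step _ ih => exact ball_succ_of_mem ih

/-- The triangle inequality. -/
theorem ball_trans {r s : ℕ} {A B : M} (hB : ∀ x, x ∊ B → x ∊ ball s A) {z : M}
    (h : z ∊ ball r B) : z ∊ ball (s + r) A := by
  induction r generalizing z with
  | zero => exact hB z h
  | succ r ih =>
    rcases mem_ball_succ.1 h with h | ⟨y, hy, hd⟩
    · exact ball_succ_of_mem (ih h)
    · exact ball_succ_of_double (ih hy) hd

theorem ball_mono {r : ℕ} {A B : M} (hB : ∀ x, x ∊ B → x ∊ A) {z : M}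
    (h : z ∊ ball r B) : z ∊ ball r A := by
  have := ball_trans (s := 0) hB h
  rwa [zero_add] at this

/-- The set `{x}`. -/
noncomputable def sing (x : M) : M := pr x x

theorem mem_sing {x z : M} : z ∊ sing x ↔ z = x := by simp [sing, mem_pr]

theorem mem_ball_sing_symm {r : ℕ} {x z : M} (h : z ∊ ball r (sing x)) : x ∊ ball r (sing z) := by
  induction r generalizing z with
  | zero => exact mem_sing.2 (mem_sing.1 h).symm
  | succ r ih =>
    rcases mem_ball_succ.1 h with h | ⟨y, hy, hd⟩
    · exact ball_succ_of_mem (ih h)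
    · rw [add_comm]
      refine ball_trans (fun w hw => ?_) (ih hy)
      rw [mem_sing.1 hw]
      exact ball_succ_of_double (r := 0) (mem_sing.2 rfl) hd.symm

theorem mem_ball_iff {r : ℕ} {A z : M} : z ∊ ball r A ↔ ∃ x, x ∊ A ∧ z ∊ ball r (sing x) := by
  constructor
  · intro h
    induction r generalizing z with
    | zero => exact ⟨z, h, mem_sing.2 rfl⟩
    | succ r ih =>
      rcases mem_ball_succ.1 h with h | ⟨y, hy, hd⟩
      · obtain ⟨x, hx, hz⟩ := ih h
        exact ⟨x, hx, ball_succ_of_mem hz⟩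
      · obtain ⟨x, hx, hz⟩ := ih hy
        exact ⟨x, hx, ball_succ_of_double hz hd⟩
  · rintro ⟨x, hx, h⟩
    refine ball_mono (fun w hw => ?_) h
    rwa [mem_sing.1 hw]

/-- The set `{a 0, …, a (n - 1)}`. -/
noncomputable def rng (a : Fin n → M) : M := coll fun z => ∃ i, z = a i

theorem mem_rng {a : Fin n → M} {z : M} : z ∊ rng a ↔ ∃ i, z = a i := by
  refine mem_coll ?_ z
  induction n with
  | zero =>
    obtain ⟨b, hb⟩ := SetAxioms.sep (Q := fun x : M => x ≠ x)
      (Dfn.not (dfn_eq (.proj 0) (.proj 0))) (Classical.arbitrary M)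
    exact ⟨b, fun z => by simp [hb]⟩
  | succ n ih =>
    obtain ⟨b, hb⟩ := ih (a := Fin.init a)
    refine ⟨cup b (sing (a (Fin.last n))), fun z => ?_⟩
    rw [mem_cup, hb, mem_sing, Fin.exists_fin_succ']
    rfl

/-- An isomorphism which maps `A` into `B` maps balls around `A` into balls around `B`, as long as it
is defined on them. -/
theorem PartialIso.mem_ball {F : M → M → Prop} {U V : M} (h : PartialIso F U V) {r : ℕ}
    {A B : M} (hAB : ∀ {x y}, F x y → x ∊ A → y ∊ B)
    (hU : ∀ x, x ∊ ball r A → x ∊ U) {x y : M} (hxy : F x y) (hx : x ∊ ball r A) : y ∊ ball r B := by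
  induction r generalizing x y with
  | zero => exact hAB hxy hx
  | succ r ih =>
    have hU' : ∀ x, x ∊ ball r A → x ∊ U := fun x hx => hU x (ball_succ_of_mem hx)
    rcases mem_ball_succ.1 hx with hx | ⟨x', hx', hd⟩
    · exact ball_succ_of_mem (ih hU' hxy hx)
    · obtain ⟨y', hy'⟩ := h.total (hU' x' hx')
      exact ball_succ_of_double (ih hU' hy' hx') ((h.double_iff hy' hxy).1 hd)

/-- There is a definable isomorphism between the balls of radius `r` around the tuples `a` and `b`
which maps `a` to `b`. -/
def LocallyIso (r : ℕ) (a b : Fin n → M) : Prop :=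
  ∃ F, PartialIso F (ball r (rng a)) (ball r (rng b)) ∧ ∀ i, F (a i) (b i)

theorem LocallyIso.symm {r : ℕ} {a b : Fin n → M} (h : LocallyIso r a b) : LocallyIso r b a := by
  obtain ⟨F, hF, hab⟩ := h
  exact ⟨_, hF.symm, hab⟩

theorem LocallyIso.refl (r : ℕ) (a : Fin n → M) : LocallyIso r a a := by
  refine ⟨_, PartialIso.refl _, fun i => ⟨?_, rfl⟩⟩
  exact ball_mono_radius (Nat.zero_le r) (mem_rng.2 ⟨i, rfl⟩)

theorem PartialIso.rng_iff {F : M → M → Prop} {U V : M} (h : PartialIso F U V) {a b : Fin n → M}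
    (hab : ∀ i, F (a i) (b i)) {x y : M} (hxy : F x y) (hx : x ∊ rng a) : y ∊ rng b := by
  obtain ⟨i, rfl⟩ := mem_rng.1 hx
  exact mem_rng.2 ⟨i, ((h.eq_iff hxy (hab i)).1 rfl)⟩

theorem PartialIso.locallyIso {F : M → M → Prop} {U V : M} (h : PartialIso F U V) {r : ℕ}
    {a b : Fin n → M} (hab : ∀ i, F (a i) (b i)) (hU : ∀ x, x ∊ ball r (rng a) → x ∊ U)
    (hV : ∀ y, y ∊ ball r (rng b) → y ∊ V) : LocallyIso r a b := by
  refine ⟨_, h.restrict hU hV fun {x y} hxy => ⟨h.mem_ball (h.rng_iff hab) hU hxy,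
    h.symm.mem_ball (h.symm.rng_iff hab) hV hxy⟩, fun i => ⟨hab i, ?_⟩⟩
  exact ball_mono_radius (Nat.zero_le r) (mem_rng.2 ⟨i, rfl⟩)

theorem LocallyIso.mono {r s : ℕ} (hrs : r ≤ s) {a b : Fin n → M} (h : LocallyIso s a b) :
    LocallyIso r a b := by
  obtain ⟨F, hF, hab⟩ := h
  exact hF.locallyIso hab (fun _ => ball_mono_radius hrs) (fun _ => ball_mono_radius hrs)

theorem mem_rng_snoc {a : Fin n → M} {x z : M} :
    z ∊ rng (Fin.snoc (α := fun _ => M) a x) ↔ z ∊ rng a ∨ z = x := by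
  simp [mem_rng, Fin.exists_fin_succ']

theorem mem_ball_rng_snoc {r : ℕ} {a : Fin n → M} {x z : M} :
    z ∊ ball r (rng (Fin.snoc (α := fun _ => M) a x)) ↔
      z ∊ ball r (rng a) ∨ z ∊ ball r (sing x) := by
  rw [mem_ball_iff, mem_ball_iff (A := rng a)]
  simp only [mem_rng_snoc, or_and_right, exists_or, exists_eq_left]

/-- Some ball around `y` contains all points which are connected to `y` by double-memberships. -/
def BoundedComponent (y : M) : Prop :=
  ∃ r : ℕ, ∀ z, Relation.ReflTransGen Double y z → z ∊ ball r (sing y)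

/-- A point `x` far from `a` is matched by a copy of the ball around `x`, which is a union of
components and is related to the points near `b` as the ball around `x` is to those near `a`. -/
theorem LocallyIso.extend_far {r : ℕ} {a b : Fin n → M} (h : LocallyIso r a b) {x : M}
    (hx : ¬ x ∊ ball (2 * r + 1) (rng a)) :
    ∃ y, LocallyIso r (Fin.snoc (α := fun _ => M) a x) (Fin.snoc (α := fun _ => M) b y) ∧
      BoundedComponent y := by
  obtain ⟨F, hF, hab⟩ := h
  set U := ball r (rng a)
  set V := ball r (rng b)
  set G := ball r (sing x) with hGdef
  have far {u : M} (hu : u ∊ G) (hu' : u ∊ ball (r + 1) (rng a)) : False := by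
    refine hx (ball_mono_radius (by lia) (ball_trans (s := r + 1) (fun w hw => ?_)
      (mem_ball_sing_symm hu)))
    rwa [mem_sing.1 hw]
  have not_mem {u : M} (hu : u ∊ G) : ¬ u ∊ U := fun h => far hu (ball_succ_of_mem h)
  have not_double {u v : M} (hu : u ∊ G) (hv : v ∊ U) : ¬ Double v u :=
    fun h => far hu (ball_succ_of_double hv h)
  have hxG : x ∊ G := ball_mono_radius (Nat.zero_le r) (mem_sing.2 rfl)
  have hP : Dfn₂ fun u c : M => ∃ v, F v c ∧ Single u v := by
    refine .ex (.and (hF.dfn.subst (.proj _) (DfnFun.proj 1).init) (.or ?_ ?_))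
    · exact dfn_mem (DfnFun.proj 0).init (.proj _)
    · exact dfn_mem (.proj _) (DfnFun.proj 0).init
  obtain ⟨g, hg, inj, mem_iff, not_mem_V, mem_g, not_mem_of_V, closed⟩ := exists_copy G V hP
  have single_cross {u v c : M} (hu : u ∊ G) (hv : F v c) : Single u v ↔ Single (g u) c := by
    have hc := (hF.dom hv).2
    have : Single (g u) c ↔ c ∊ g u := by simp [Single, not_mem_of_V u c hu hc]
    rw [this, mem_g u c hu hc]
    refine ⟨fun h => ⟨v, hv, h⟩, ?_⟩
    rintro ⟨v', hv', h⟩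
    rwa [(hF.eq_iff hv hv').2 rfl]
  have double_cross {u v c : M} (hu : u ∊ G) (hv : F v c) : Double u v ↔ Double (g u) c := by
    have hd := hF.dom hv
    exact iff_of_false (fun h => not_double hu hd.1 h.symm)
      fun h => not_mem_of_V u c hu hd.2 h.1
  have eq_cross {u v c : M} (hu : u ∊ G) (hv : F v c) : u = v ↔ g u = c := by
    have hd := hF.dom hv
    refine iff_of_false ?_ ?_
    · rintro rfl
      exact not_mem hu hd.1
    · rintro rfl
      exact not_mem_V u hu hd.2
  have hF' : PartialIso (fun v c => F v c ∨ v ∊ G ∧ c = g v) (cup U G) (cup V (image g G)) := by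
    refine ⟨.or hF.dfn (.and (dfn_mem (.proj 0) (.const G)) hg.dfn₂), ?_, ?_, ?_, ?_, ?_, ?_⟩
    · rintro v c (h | ⟨h, rfl⟩)
      · exact ⟨mem_cup.2 (Or.inl (hF.dom h).1), mem_cup.2 (Or.inl (hF.dom h).2)⟩
      · exact ⟨mem_cup.2 (Or.inr h), mem_cup.2 (Or.inr ((mem_image hg).2 ⟨v, h, rfl⟩))⟩
    · intro v hv
      rcases mem_cup.1 hv with hv | hv
      · obtain ⟨c, hc⟩ := hF.total hv
        exact ⟨c, Or.inl hc⟩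
      · exact ⟨g v, Or.inr ⟨hv, rfl⟩⟩
    · intro c hc
      rcases mem_cup.1 hc with hc | hc
      · obtain ⟨v, hv⟩ := hF.surj hc
        exact ⟨v, Or.inl hv⟩
      · obtain ⟨u, hu, rfl⟩ := (mem_image hg).1 hc
        exact ⟨u, Or.inr ⟨hu, rfl⟩⟩
    · rintro v c v' c' (h | ⟨h, rfl⟩) (h' | ⟨h', rfl⟩)
      · exact hF.eq_iff h h'
      · rw [eq_comm, eq_comm (a := c)]
        exact eq_cross h' h
      · exact eq_cross h h'
      · exact ⟨fun e => e ▸ rfl, inj v v' h h'⟩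
    · rintro v c v' c' (h | ⟨h, rfl⟩) (h' | ⟨h', rfl⟩)
      · exact hF.single_iff h h'
      · rw [single_comm, single_comm (x := c)]
        exact single_cross h' h
      · exact single_cross h h'
      · exact or_congr (mem_iff v v' h h').symm (mem_iff v' v h' h).symm
    · rintro v c v' c' (h | ⟨h, rfl⟩) (h' | ⟨h', rfl⟩)
      · exact hF.double_iff h h'
      · rw [double_comm, double_comm (x := c)]
        exact double_cross h' h
      · exact double_cross h h'
      · exact and_congr (mem_iff v v' h h').symm (mem_iff v' v h' h).symm
  have closed' {z z' : M} (hz : z ∊ image g G) (hd : Double z z') : z' ∊ image g G := by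
    obtain ⟨u, hu, rfl⟩ := (mem_image hg).1 hz
    obtain ⟨v, hv, rfl⟩ := closed u z' hu hd.2 hd.1
    exact (mem_image hg).2 ⟨v, hv, rfl⟩
  have hyG : g x ∊ image g G := (mem_image hg).2 ⟨x, hxG, rfl⟩
  have ball_sub (s : ℕ) : ∀ z, z ∊ ball s (sing (g x)) → z ∊ image g G := by
    induction s with
    | zero =>
      intro z hz
      rwa [mem_sing.1 hz]
    | succ s ih =>
      intro z hz
      rcases mem_ball_succ.1 hz with hz | ⟨y, hy, hd⟩
      · exact ih z hz
      · exact closed' (ih y hy) hd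
  refine ⟨g x, hF'.locallyIso ?_ ?_ ?_, r, fun z hz => ?_⟩
  · intro i
    refine Fin.lastCases ?_ (fun i => ?_) i
    · rw [Fin.snoc_last, Fin.snoc_last]
      exact Or.inr ⟨hxG, rfl⟩
    · rw [Fin.snoc_castSucc, Fin.snoc_castSucc]
      exact Or.inl (hab i)
  · intro z hz
    exact mem_cup.2 (mem_ball_rng_snoc.1 hz)
  · intro z hz
    exact mem_cup.2 ((mem_ball_rng_snoc.1 hz).imp_right (ball_sub r z))
  · have hzG : z ∊ image g G := by
      induction hz with
      | refl => exact hyG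
      | tail _ hd ih => exact closed' ih hd
    obtain ⟨u, hu, rfl⟩ := (mem_image hg).1 hzG
    refine hF'.mem_ball (A := sing x) ?_ (fun w hw => mem_cup.2 (Or.inr hw))
      (Or.inr ⟨hu, rfl⟩) hu
    intro v c hvc hv
    rw [mem_sing] at hv ⊢
    exact (hF'.eq_iff hvc (Or.inr ⟨hxG, rfl⟩)).1 hv

/-- The back-and-forth step: to lower the radius from `3 * r + 1` to `r` allows one more point. The
new point is near the old ones or lies in a component of finite diameter. -/
theorem LocallyIso.extend {r : ℕ} {a b : Fin n → M} (h : LocallyIso (3 * r + 1) a b) (x : M) :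
    ∃ y, LocallyIso r (Fin.snoc (α := fun _ => M) a x) (Fin.snoc (α := fun _ => M) b y) ∧
      (y ∊ ball (3 * r + 1) (rng b) ∨ BoundedComponent y) := by
  by_cases hx : x ∊ ball (2 * r + 1) (rng a)
  · obtain ⟨F, hF, hab⟩ := h
    obtain ⟨y, hy⟩ := hF.total (ball_mono_radius (by lia) hx)
    have hyb : y ∊ ball (2 * r + 1) (rng b) :=
      hF.mem_ball (hF.rng_iff hab) (fun _ => ball_mono_radius (by lia)) hy hx
    have sub {a : Fin n → M} {x z : M} (hx : x ∊ ball (2 * r + 1) (rng a))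
        (hz : z ∊ ball r (rng (Fin.snoc (α := fun _ => M) a x))) :
        z ∊ ball (3 * r + 1) (rng a) := by
      rw [show 3 * r + 1 = 2 * r + 1 + r by lia]
      refine ball_trans (fun w hw => ?_) hz
      rcases mem_rng_snoc.1 hw with hw | rfl
      · exact ball_mono_radius (Nat.zero_le _) hw
      · exact hx
    refine ⟨y, hF.locallyIso ?_ (fun z => sub hx) (fun z => sub hyb),
      Or.inl (ball_mono_radius (by lia) hyb)⟩
    intro i
    refine Fin.lastCases ?_ (fun i => ?_) i
    · simpa using hy
    · simpa using hab i
  · obtain ⟨y, hy, hyb⟩ := (h.mono (r := r) (by lia)).extend_far hx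
    exact ⟨y, hy, Or.inr hyb⟩

end Balls

/-! ### Formulas of the SD-graph are local -/

section Formulas

theorem exists_realize_eq_var {n : ℕ} (t : langSD.Term (Empty ⊕ Fin n)) :
    ∃ i, t = Term.var (Sum.inr i) := by
  rcases t with (x | i) | f
  · exact x.elim
  · exact ⟨i, rfl⟩
  · exact Empty.elim f

theorem relMap_double {M : Type*} [langMem.Structure M] (v : Fin 2 → SDGraph M) :
    Structure.RelMap (L := langSD) SDRel.double v ↔ Double (M := M) (v 0) (v 1) := Iff.rfl

theorem relMap_single {M : Type*} [langMem.Structure M] (v : Fin 2 → SDGraph M) :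
    Structure.RelMap (L := langSD) SDRel.single v ↔ Single (M := M) (v 0) (v 1) := Iff.rfl

/-- Every formula of the language of SD-graphs has a radius such that its truth at a tuple only
depends on the isomorphism type of the ball of this radius around the tuple. -/
theorem exists_radius {M : Type*} [langMem.Structure M] [SetAxioms M] {n : ℕ}
    (φ : langSD.BoundedFormula Empty n) :
    ∃ r, ∀ a b : Fin n → M, LocallyIso r a b →
      (φ.Realize (M := SDGraph M) default a ↔ φ.Realize (M := SDGraph M) default b) := by
  induction φ with
  | falsum => exact ⟨0, fun a b _ => Iff.rfl⟩
  | equal s t =>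
    obtain ⟨i, rfl⟩ := exists_realize_eq_var s
    obtain ⟨j, rfl⟩ := exists_realize_eq_var t
    refine ⟨0, fun a b ⟨F, hF, hab⟩ => ?_⟩
    exact hF.eq_iff (hab i) (hab j)
  | rel R ts =>
    refine ⟨0, fun a b ⟨F, hF, hab⟩ => ?_⟩
    cases R with
    | single =>
      obtain ⟨i, hi⟩ := exists_realize_eq_var (ts 0)
      obtain ⟨j, hj⟩ := exists_realize_eq_var (ts 1)
      simp only [BoundedFormula.Realize, relMap_single, hi, hj]
      exact hF.single_iff (hab i) (hab j)
    | double =>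
      obtain ⟨i, hi⟩ := exists_realize_eq_var (ts 0)
      obtain ⟨j, hj⟩ := exists_realize_eq_var (ts 1)
      simp only [BoundedFormula.Realize, relMap_double, hi, hj]
      exact hF.double_iff (hab i) (hab j)
  | imp φ ψ ihφ ihψ =>
    obtain ⟨r, hr⟩ := ihφ
    obtain ⟨s, hs⟩ := ihψ
    exact ⟨max r s, fun a b h =>
      imp_congr (hr a b (h.mono (le_max_left r s))) (hs a b (h.mono (le_max_right r s)))⟩
  | all φ ih =>
    obtain ⟨r, hr⟩ := ih
    have key (a b : Fin _ → M) (h : LocallyIso (3 * r + 1) a b)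
        (ha : ∀ x : SDGraph M, φ.Realize (M := SDGraph M) default (Fin.snoc a x)) (y : SDGraph M) :
        φ.Realize (M := SDGraph M) default (Fin.snoc b y) := by
      obtain ⟨x, hx, -⟩ := h.symm.extend y
      exact (hr _ _ hx).2 (ha x)
    exact ⟨3 * r + 1, fun a b h => ⟨key a b h, key b a h.symm⟩⟩

end Formulas

/-! ### Components of finite diameter -/

section Components

local infix:50 " ∊ " => Mem

theorem reductGraph_adj {A : Type*} [langSD.Structure A] {x y : A} :
    (reductGraph A).Adj x y ↔ x ≠ y ∧
      (Structure.RelMap (L := langSD) SDRel.double ![x, y] ∨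
        Structure.RelMap (L := langSD) SDRel.double ![y, x]) := Iff.rfl

theorem adj_sdGraph {M : Type*} [langMem.Structure M] {x y : M} :
    (reductGraph (SDGraph M)).Adj x y ↔ x ≠ y ∧ Double x y := by
  refine reductGraph_adj.trans (and_congr_right fun _ => ?_)
  change Double x y ∨ Double y x ↔ _
  rw [double_comm (x := y), or_self]

theorem reachable_of_double {M : Type*} [langMem.Structure M] {x y : M} (h : Double x y) :
    (reductGraph (SDGraph M)).Reachable x y := by
  by_cases hxy : x = y
  · exact hxy ▸ SimpleGraph.Reachable.refl _
  · exact SimpleGraph.Adj.reachable (adj_sdGraph.2 ⟨hxy, h⟩)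

theorem reachable_of_mem_ball {M : Type*} [langMem.Structure M] [SetAxioms M] {r : ℕ} {x z : M}
    (h : z ∊ ball r (sing x)) : (reductGraph (SDGraph M)).Reachable x z := by
  induction r generalizing z with
  | zero => exact mem_sing.1 h ▸ SimpleGraph.Reachable.refl _
  | succ r ih =>
    rcases mem_ball_succ.1 h with h | ⟨y, hy, hd⟩
    · exact ih h
    · exact (ih hy).trans (reachable_of_double hd)

theorem BoundedComponent.not_infiniteDiam {M : Type*} [langMem.Structure M] [SetAxioms M] {y : M}
    (h : BoundedComponent y) :
    ¬ InfiniteDiam ((reductGraph (SDGraph M)).connectedComponentMk y) := by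
  obtain ⟨r, hr⟩ := h
  set C := (reductGraph (SDGraph M)).connectedComponentMk y with hC
  have hy : y ∈ C := rfl
  have mem {z : M} (hz : (reductGraph (SDGraph M)).Reachable y z) : z ∈ C :=
    SimpleGraph.ConnectedComponent.sound hz.symm
  have dist (s : ℕ) (z : M) (hz : z ∊ ball s (sing y)) :
      C.toSimpleGraph.edist ⟨y, hy⟩ ⟨z, mem (reachable_of_mem_ball hz)⟩ ≤ s := by
    induction s generalizing z with
    | zero =>
      obtain rfl := mem_sing.1 hz
      simp
    | succ s ih =>
      rcases mem_ball_succ.1 hz with hz' | ⟨w, hw, hd⟩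
      · exact (ih z hz').trans (by exact_mod_cast Nat.le_succ s)
      · refine SimpleGraph.edist_triangle.trans
          ((add_le_add (ih w hw) ?_).trans_eq (Nat.cast_succ s).symm)
        refine SimpleGraph.edist_le_one_iff_adj_or_eq.2 ?_
        by_cases hwz : w = z
        · exact Or.inr (Subtype.ext hwz)
        · exact Or.inl (adj_sdGraph (M := M).2 ⟨hwz, hd⟩)
  have dist' (z : C) : C.toSimpleGraph.edist ⟨y, hy⟩ z ≤ r := by
    obtain ⟨z, hz⟩ := z
    have hreach : (reductGraph (SDGraph M)).Reachable y z :=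
      (SimpleGraph.ConnectedComponent.exact hz).symm
    exact dist r z (hr z (Relation.ReflTransGen.lift (p := Double (M := M)) (fun w => w)
      (fun _ _ h => (adj_sdGraph (M := M).1 h).2) _ _
      ((SimpleGraph.reachable_iff_reflTransGen _ _).1 hreach)))
  have : C.toSimpleGraph.ediam ≤ (r + r : ℕ) := by
    refine SimpleGraph.ediam_le_of_edist_le fun u v => ?_
    refine (SimpleGraph.edist_triangle (v := ⟨y, hy⟩)).trans ?_
    rw [SimpleGraph.edist_comm, Nat.cast_add]
    exact add_le_add (dist' u) (dist' v)
  exact fun h => absurd (this.trans_lt (ENat.natCast_lt_top _)) (by rw [h]; exact lt_irrefl _)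

/-- Deleting whole components does not change the remaining ones. -/
theorem not_infiniteDiam_finiteDiamPart {A : Type*} [langSD.Structure A]
    (C : (reductGraph (finiteDiamPart A)).ConnectedComponent) : ¬ InfiniteDiam C := by
  obtain ⟨x, rfl⟩ := C.exists_rep
  set C := (reductGraph (finiteDiamPart A)).connectedComponentMk x
  set B := (reductGraph A).connectedComponentMk x
  have hB : ¬ InfiniteDiam B := x.2
  have adj {u v : finiteDiamPart A} :
      (reductGraph (finiteDiamPart A)).Adj u v ↔ (reductGraph A).Adj u v := by
    have (u v : finiteDiamPart A) : Structure.RelMap (L := langSD) SDRel.double ![u, v] ↔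
        Structure.RelMap (L := langSD) SDRel.double ![(u : A), v] := by
      refine iff_of_eq (congrArg (Structure.RelMap (L := langSD) (M := A) SDRel.double) ?_)
      ext i
      fin_cases i <;> rfl
    rw [reductGraph_adj, reductGraph_adj, this, this, Ne, Subtype.ext_iff]
  have mem {z : A} (hz : z ∈ B) : z ∈ finiteDiamPart A := by
    change ¬ InfiniteDiam _
    rwa [show (reductGraph A).connectedComponentMk z = B from hz]
  let f : B.toSimpleGraph →g reductGraph (finiteDiamPart A) :=
    { toFun := fun z => ⟨z, mem z.2⟩
      map_rel' := fun {u v} h => adj.2 h }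
  let f' : B.toSimpleGraph →g C.toSimpleGraph :=
    { toFun := fun z => ⟨f z, SimpleGraph.ConnectedComponent.sound
        ((B.connected_toSimpleGraph.preconnected z ⟨x, rfl⟩).map f)⟩
      map_rel' := fun {u v} h => f.map_rel' h }
  refine fun hC => hB (top_unique (hC.symm.trans_le (SimpleGraph.ediam_le_of_edist_le ?_)))
  rintro ⟨u, hu⟩ ⟨v, hv⟩
  have hBmem {u : finiteDiamPart A} (hu : u ∈ C) : (u : A) ∈ B := by
    let i : reductGraph (finiteDiamPart A) →g reductGraph A :=
      { toFun := fun z => z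
        map_rel' := adj.1 }
    exact SimpleGraph.ConnectedComponent.sound
      ((SimpleGraph.ConnectedComponent.exact hu).map i)
  obtain ⟨p, hp⟩ := (B.connected_toSimpleGraph ⟨u, hBmem hu⟩
    ⟨v, hBmem hv⟩).exists_walk_length_eq_edist
  refine le_trans ?_ (SimpleGraph.edist_le_ediam (u := ⟨u, hBmem hu⟩) (v := ⟨v, hBmem hv⟩))
  rw [← hp, ← p.length_map f']
  exact SimpleGraph.edist_le _

end Components

/-! ### The elementary substructure and passage to countable models -/

section Transfer

/-- The Tarski–Vaught test holds since the witness provided by the back-and-forth step can be found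
in a component of finite diameter. -/
theorem finiteDiamPart_elementarilyEquivalent (M : Type*) [langMem.Structure M] [SetAxioms M] :
    finiteDiamPart (SDGraph M) ≅[langSD] SDGraph M := by
  refine ((finiteDiamPart (SDGraph M)).toElementarySubstructure ?_).elementarilyEquivalent
  intro n φ v x hx
  obtain ⟨r, hr⟩ := exists_radius (M := M) φ
  let a : Fin n → M := fun i => (v i : SDGraph M)
  obtain ⟨y, hy, hyN⟩ := (LocallyIso.refl (3 * r + 1) a).extend (x : M)
  refine ⟨⟨y, ?_⟩, (hr _ _ hy).1 hx⟩
  rcases hyN with hyN | hyN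
  · obtain ⟨z, hz, hzy⟩ := mem_ball_iff.1 hyN
    obtain ⟨i, rfl⟩ := mem_rng.1 hz
    change ¬ InfiniteDiam ((reductGraph (SDGraph M)).connectedComponentMk y)
    rw [← SimpleGraph.ConnectedComponent.sound (reachable_of_mem_ball hzy)]
    exact (v i).2
  · exact hyN.not_infiniteDiam

theorem countable_symbols : Countable langMem.Symbols := by
  have (l : ℕ) : Countable (langMem.Functions l) := inferInstanceAs (Countable Empty)
  have (l : ℕ) : Countable (langMem.Relations l) := by
    refine (?_ : Subsingleton (MemRel l)).to_countable
    constructor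
    rintro ⟨⟩ ⟨⟩
    rfl
  exact inferInstanceAs (Countable ((Σ l, langMem.Functions l) ⊕ Σ l, langMem.Relations l))

/-- A finite model would have a set of all sets. -/
theorem infinite_of_setAxioms (M : Type*) [langMem.Structure M] [SetAxioms M] : Infinite M := by
  refine not_finite_iff_infinite.1 fun hfin => ?_
  obtain ⟨n, ⟨e⟩⟩ := Finite.exists_equiv_fin M
  obtain ⟨p, hp, -⟩ := exists_fresh (rng e.symm)
  exact hp (mem_rng.2 ⟨e p, by simp⟩)

/-- The atomic formulas of the SD-graph in the language of set theory. -/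
def translateRel {n : ℕ} : ∀ {l : ℕ}, SDRel l → (Fin l → Fin n) → Fml n
  | _, .single, i => memF (i 0) (i 1) ⊔ memF (i 1) (i 0)
  | _, .double, i => memF (i 0) (i 1) ⊓ memF (i 1) (i 0)

/-- The interpretation of the SD-graph in the language of set theory. -/
noncomputable def translate : ∀ {n : ℕ}, langSD.BoundedFormula Empty n → Fml n
  | _, .falsum => ⊥
  | _, .equal s t => eqF (exists_realize_eq_var s).choose (exists_realize_eq_var t).choose
  | _, .rel R ts => translateRel R fun k => (exists_realize_eq_var (ts k)).choose
  | _, .imp φ ψ => (translate φ).imp (translate ψ)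
  | _, .all φ => (translate φ).all

theorem realize_translate {M : Type*} [langMem.Structure M] {n : ℕ}
    (φ : langSD.BoundedFormula Empty n) (v : Fin n → M) :
    (translate φ).Realize default v ↔ φ.Realize (M := SDGraph M) default v := by
  have var {n : ℕ} (t : langSD.Term (Empty ⊕ Fin n)) (v : Fin n → M) :
      t.realize (M := SDGraph M) (Sum.elim default v) = v (exists_realize_eq_var t).choose := by
    conv_lhs => rw [(exists_realize_eq_var t).choose_spec]
    rfl
  induction φ with
  | falsum => exact Iff.rfl
  | equal s t =>
    rw [translate, realize_eqF]
    exact iff_of_eq (congrArg₂ _ (var s v).symm (var t v).symm)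
  | rel R ts =>
    cases R with
    | single =>
      rw [translate, translateRel, BoundedFormula.realize_sup, realize_memF, realize_memF]
      exact iff_of_eq (congrArg₂ Single (var (ts 0) v).symm (var (ts 1) v).symm)
    | double =>
      rw [translate, translateRel, BoundedFormula.realize_inf, realize_memF, realize_memF]
      exact iff_of_eq (congrArg₂ Double (var (ts 0) v).symm (var (ts 1) v).symm)
  | imp φ ψ ihφ ihψ => exact imp_congr (ihφ v) (ihψ v)
  | all φ ih => exact forall_congr' fun x => ih (Fin.snoc v x)

theorem sdGraph_elementarilyEquivalent {M N : Type*} [langMem.Structure M] [langMem.Structure N]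
    (h : M ≅[langMem] N) : SDGraph M ≅[langSD] SDGraph N := by
  refine elementarilyEquivalent_iff.2 fun σ => ?_
  exact (realize_translate σ (default : Fin 0 → M)).symm.trans
    ((elementarilyEquivalent_iff.1 h (translate σ)).trans
      (realize_translate σ (default : Fin 0 → N)))

end Transfer

end DoubleMembership

open DoubleMembership in
theorem mainTheorem3 {M : Type*} [langMem.Structure M] (hM : M ⊨ ZFA) :
    (∃ (N : Type) (_ : langSD.Structure N),
      Countable N ∧ (N ≅[langSD] SDGraph M) ∧
        ∀ C : (reductGraph N).ConnectedComponent, ¬ InfiniteDiam C) ∧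
    (Countable M →
      (finiteDiamPart (SDGraph M) ≅[langSD] SDGraph M) ∧
        ∀ C : (reductGraph (finiteDiamPart (SDGraph M))).ConnectedComponent,
          ¬ InfiniteDiam C) := by
  have hS := setAxioms_of_model hM
  have := infinite_of_setAxioms M
  refine ⟨?_, fun _ => ⟨finiteDiamPart_elementarilyEquivalent M,
    not_infiniteDiam_finiteDiamPart⟩⟩
  obtain ⟨K, hMK, hK⟩ := exists_elementarilyEquivalent_card_eq langMem M Cardinal.aleph0.{0} le_rfl
    (by
      have : Countable langMem.Symbols := countable_symbols
      rw [Cardinal.lift_id, Cardinal.lift_id]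
      exact Cardinal.mk_le_aleph0)
  have hKM : K ⊨ ZFA := hMK.theory_model
  have hKS := setAxioms_of_model hKM
  have : Countable K := Cardinal.mk_le_aleph0_iff.1 hK.le
  exact ⟨finiteDiamPart (SDGraph K), inferInstance,
    (Subtype.val_injective (p := (· ∈ finiteDiamPart (SDGraph K)))).countable (β := K),
    (finiteDiamPart_elementarilyEquivalent K).trans (sdGraph_elementarilyEquivalent hMK.symm),
    not_infiniteDiam_finiteDiamPart⟩
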